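/- **Theorem 1 (Reverse ALT inequality).** Let $A$ and $B$ be non-negative (positive semidefinite) operators on a finite-dimensional complex Hilbert space and let $q>0$. For a linear operator $L$ write $\|L\|_p=(\mathrm{tr}\,|L|^p)^{1/p}$ with $|L|=\sqrt{L^*L}$ for $0<p<\infty$, and let $\|L\|_\infty$ be the operator norm; put $1/\infty=0$. (i) For all $r\in(0,1]$ and $a,b\in(0,\infty]$ with $\frac1{2rq}=\frac1{2q}+\frac1a+\frac1b$, $$\mathrm{tr}\,\big(B^{\frac12}AB^{\frac12}\big)^{rq}\le\Big(\mathrm{tr}\,\big(B^{\frac r2}A^rB^{\frac r2}\big)^q\Big)^r\,\big\|A^{\frac{1-r}2}\big\|_a^{2rq}\,\big\|B^{\frac{1-r}2}\big\|_b^{2rq}.$$ (ii) For all $r\in[1,\infty)$ and $a,b\in(0,\infty]$ with $\frac1{2q}=\frac1{2rq}+\frac1a+\frac1b$, $$\mathrm{tr}\,\big(B^{\frac12}AB^{\frac12}\big)^{rq}\ge\Big(\mathrm{tr}\,\big(B^{\frac r2}A^rB^{\frac r2}\big)^q\Big)^r\,\big\|A^{\frac{r-1}2}\big\|_a^{-2rq}\,\big\|B^{\frac{r-1}2}\big\|_b^{-2rq},$$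 where the right-hand side is read as $0$ if $A=0$ or $B=0$. -/

import Mathlib

noncomputable section

/-- The trace `tr X` of a linear operator `X` on a finite-dimensional complex Hilbert space, as a
real number (its real part; it is only used for non-negative `X`, whose trace is real). -/
def opTrace {H : Type*} [NormedAddCommGroup H] [InnerProductSpace ℂ H]
    (X : H →L[ℂ] H) : ℝ :=
  (LinearMap.trace ℂ H (X : H →ₗ[ℂ] H)).re

/-- The Schatten (quasi-)norm `‖L‖_p = (tr |L| ^ p) ^ (1 / p)` for `0 < p < ∞`, where
`|L| = √(L* L)`, and the operator norm of `L` for `p = ∞`. (It is not meant for `p = 0`.) -/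
def schattenNorm {H : Type*} [NormedAddCommGroup H] [InnerProductSpace ℂ H] [CompleteSpace H]
    (p : ENNReal) (L : H →L[ℂ] H) : ℝ :=
  if p = ⊤ then ‖L‖ else opTrace (CFC.abs L ^ p.toReal) ^ (1 / p.toReal)

end

/-! Since `B^(s/2) A^s B^(s/2) = |A^(s/2) B^(s/2)|²`, both traces are powers of Schatten quasi-norms
of `A^(s/2) B^(s/2)`, with `s = 1` and `s = r`. For `r ≤ 1`, factor `A^(1/2) B^(1/2)` as
`A^((1-r)/2) (A^(r/2) B^(r/2)) B^((1-r)/2)` and apply three-factor Hölder; for `r ≥ 1`, factor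
`A^(r/2) B^(r/2)` around `A^(1/2) B^(1/2)` instead and divide. Exponents below 1 occur, so Hölder is
derived from Horn's inequality: partial products of singular values are submultiplicative.
Log-majorization turns this into a bound on sums of powers, and scalar Hölder finishes. Horn's
inequality itself follows from Gram determinants and Cauchy–Binet. -/

open Finset in
/-- A nonnegative antitone sequence whose partial products are dominated by those of a nonnegative
sequence has dominated partial sums. -/
theorem sum_range_le_of_prod_range_le {x y : ℕ → ℝ} (hx : Antitone x) (hx0 : ∀ i, 0 ≤ x i)
    (hy0 : ∀ i, 0 ≤ y i) (n : ℕ)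
    (h : ∀ k ≤ n, ∏ i ∈ range k, x i ≤ ∏ i ∈ range k, y i) :
    ∑ i ∈ range n, x i ≤ ∑ i ∈ range n, y i := by
  induction n with
  | zero => simp
  | succ n ih =>
    -- A vanishing last term reduces to the shorter sum; otherwise all terms are positive and have
    -- logarithms.
    rcases (hx0 n).eq_or_lt with h0 | h0
    · rw [sum_range_succ, sum_range_succ, ← h0]
      have := ih fun k hk => h k (hk.trans n.le_succ)
      linarith [hy0 n]
    have hxp : ∀ i ∈ range (n + 1), 0 < x i := fun i hi =>
      h0.trans_le (hx (Nat.lt_succ_iff.1 (mem_range.1 hi)))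
    have hyp : ∀ i ∈ range (n + 1), 0 < y i := by
      have hpos : 0 < ∏ i ∈ range (n + 1), y i := (prod_pos hxp).trans_le (h _ le_rfl)
      exact fun i hi => (hy0 i).lt_of_ne fun hi0 =>
        hpos.ne' (prod_eq_zero hi hi0.symm)
    have hlog : ∀ k ≤ n + 1, 0 ≤ ∑ i ∈ range k, (Real.log (y i) - Real.log (x i)) := by
      intro k hk
      have hsub : ∀ i ∈ range k, i ∈ range (n + 1) := fun i hi => range_mono hk hi
      rw [sum_sub_distrib, ← Real.log_prod fun i hi => (hyp i (hsub i hi)).ne',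
        ← Real.log_prod fun i hi => (hxp i (hsub i hi)).ne', sub_nonneg]
      exact Real.log_le_log (prod_pos fun i hi => hxp i (hsub i hi)) (h k hk)
    -- Abel summation: decreasing weights against nonnegative partial sums.
    have habel : ∀ k ≤ n, x k * ∑ i ∈ range (k + 1), (Real.log (y i) - Real.log (x i)) ≤
        ∑ i ∈ range (k + 1), x i * (Real.log (y i) - Real.log (x i)) := by
      intro k
      induction k with
      | zero => simp
      | succ k ihk =>
        intro hk
        rw [sum_range_succ, sum_range_succ _ (k + 1), mul_add]
        have h1 := ihk (by omega)
        have h2 := mul_le_mul_of_nonneg_right (hx k.le_succ) (hlog (k + 1) (by omega))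
        linarith
    have hterm : ∀ i ∈ range (n + 1), x i * (Real.log (y i) - Real.log (x i)) ≤ y i - x i := by
      intro i hi
      have hxi := hxp i hi
      have hyi := hyp i hi
      have h1 := Real.log_le_sub_one_of_pos (div_pos hyi hxi)
      rw [Real.log_div hyi.ne' hxi.ne'] at h1
      calc _ ≤ x i * (y i / x i - 1) := mul_le_mul_of_nonneg_left h1 hxi.le
        _ = y i - x i := by field_simp
    have h3 := sum_le_sum hterm
    rw [sum_sub_distrib] at h3
    have h4 := (mul_nonneg h0.le (hlog _ le_rfl)).trans (habel n le_rfl)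
    linarith

/-! ### Gram determinants and Horn's inequality -/

open Finset in
theorem prod_le_prod_range_card {d : ℕ → ℝ} (hd : Antitone d) (hd0 : ∀ i, 0 ≤ d i)
    (s : Finset ℕ) : ∏ i ∈ s, d i ≤ ∏ i ∈ range #s, d i := by
  induction s using Finset.induction_on_max with
  | empty => simp
  | insert m s hm ih =>
    have hms : m ∉ s := fun h => (hm m h).false
    have hcard : #s ≤ m := by
      simpa using card_le_card (show s ⊆ range m from fun i hi => mem_range.2 (hm i hi))
    rw [prod_insert hms, card_insert_of_notMem hms, prod_range_succ, mul_comm]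
    exact mul_le_mul ih (hd hcard) (hd0 _) (prod_nonneg fun i _ => hd0 i)

open Finset Matrix in
/-- A symmetrized form of the Cauchy–Binet formula. -/
theorem factorial_mul_det_conjTranspose_mul_diagonal_mul {n k : ℕ} (C : Matrix (Fin n) (Fin k) ℂ)
    (d : Fin n → ℂ) :
    (k.factorial : ℂ) * (Cᴴ * diagonal d * C).det =
      ∑ f : Fin k → Fin n, (∏ i, d (f i)) * (Complex.normSq (C.submatrix f id).det : ℂ) := by
  have hdet : (Cᴴ * diagonal d * C).det =
      ∑ f : Fin k → Fin n, (∏ i, star (C (f i) i) * d (f i)) * (C.submatrix f id).det := by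
    have hrow : Cᴴ * diagonal d * C =
        fun i => ∑ l, (star (C l i) * d l) • C l := by
      ext i j
      simp only [mul_apply (M := Cᴴ * diagonal d), mul_diagonal, conjTranspose_apply,
        Finset.sum_apply, Pi.smul_apply, smul_eq_mul]
    rw [hrow]
    change detRowAlternating.toMultilinearMap _ = _
    rw [MultilinearMap.map_sum]
    refine sum_congr rfl fun f _ => ?_
    rw [MultilinearMap.map_smul_univ]
    rfl
  -- Reindexing by `σ` costs a sign; summing over all `σ` assembles the conjugate minor and produces
  -- the factor `k!`.
  have hperm : ∀ σ : Equiv.Perm (Fin k), (Cᴴ * diagonal d * C).det =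
      ∑ f : Fin k → Fin n, (∏ i, d (f i)) * ((Equiv.Perm.sign σ : ℤ) *
        (∏ i, star (C (f (σ i)) i)) * (C.submatrix f id).det) := by
    intro σ
    rw [hdet, ← (Equiv.arrowCongr σ.symm (Equiv.refl (Fin n))).sum_comp]
    refine sum_congr rfl fun f _ => ?_
    have h1 : (C.submatrix (f ∘ σ) id).det = (Equiv.Perm.sign σ : ℤ) * (C.submatrix f id).det := by
      rw [← det_permute]; rfl
    have h2 : ∏ i, d (f (σ i)) = ∏ i, d (f i) := Equiv.prod_comp σ fun i => d (f i)
    change (∏ i, star (C (f (σ i)) i) * d (f (σ i))) * (C.submatrix (f ∘ σ) id).det = _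
    rw [h1, prod_mul_distrib, h2]
    ring
  calc (k.factorial : ℂ) * (Cᴴ * diagonal d * C).det
      = ∑ σ : Equiv.Perm (Fin k), (Cᴴ * diagonal d * C).det := by
        simp [Fintype.card_perm]
    _ = ∑ f : Fin k → Fin n, (∏ i, d (f i)) * ((∑ σ : Equiv.Perm (Fin k),
          (Equiv.Perm.sign σ : ℤ) * (∏ i, star (C (f (σ i)) i))) * (C.submatrix f id).det) := by
        rw [sum_congr rfl fun σ _ => hperm σ, sum_comm]
        simp only [← mul_sum, ← sum_mul]
    _ = _ := by
        refine sum_congr rfl fun f _ => ?_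
        rw [← Complex.mul_conj, mul_comm (C.submatrix f id).det]
        congr 2
        change _ = star _
        rw [det_apply', star_sum]
        simp [star_prod]

-- Compare Cauchy–Binet sums termwise: minors with a repeated row vanish, and distinct indices give
-- at most the product of the `k` largest weights.
open Finset Matrix in
theorem re_det_conjTranspose_mul_diagonal_mul_le {n k : ℕ} (C : Matrix (Fin n) (Fin k) ℂ)
    {d : ℕ → ℝ} (hd : Antitone d) (hd0 : ∀ i, 0 ≤ d i) :
    (Cᴴ * diagonal (fun i : Fin n => (d i : ℂ)) * C).det.re ≤
      (∏ i ∈ range k, d i) * (Cᴴ * C).det.re := by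
  have h1 := congrArg Complex.re
    (factorial_mul_det_conjTranspose_mul_diagonal_mul C fun i : Fin n => (d i : ℂ))
  have h2 := congrArg Complex.re (factorial_mul_det_conjTranspose_mul_diagonal_mul C fun _ => 1)
  simp only [← Complex.ofReal_prod, ← Complex.ofReal_mul, ← Complex.ofReal_natCast,
    Complex.re_ofReal_mul, Complex.re_sum, Complex.ofReal_re, prod_const_one, one_mul,
    diagonal_one, Matrix.mul_one] at h1 h2
  have hk : (0 : ℝ) < k.factorial := by exact_mod_cast k.factorial_pos
  refine le_of_mul_le_mul_left ?_ hk
  rw [h1, mul_left_comm, h2, mul_sum]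
  refine sum_le_sum fun f _ => ?_
  by_cases hf : Function.Injective f
  · refine mul_le_mul_of_nonneg_right ?_ (Complex.normSq_nonneg _)
    have hinj : Function.Injective fun i => (f i : ℕ) := Fin.val_injective.comp hf
    have := prod_le_prod_range_card hd hd0 (univ.image fun i => (f i : ℕ))
    rwa [card_image_of_injective _ hinj, prod_image hinj.injOn, card_univ, Fintype.card_fin]
      at this
  · obtain ⟨i, j, hij, hne⟩ := Function.not_injective_iff.1 hf
    rw [det_zero_of_row_eq hne (by ext l; simp [hij])]
    simp

open Module LinearMap in
theorem exists_orthonormalBasis_adjoint_apply {E F : Type*} [NormedAddCommGroup E]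
    [InnerProductSpace ℂ E] [FiniteDimensional ℂ E] [NormedAddCommGroup F]
    [InnerProductSpace ℂ F] [FiniteDimensional ℂ F] (T : E →ₗ[ℂ] F) :
    ∃ e : OrthonormalBasis (Fin (finrank ℂ E)) ℂ E,
      ∀ i, adjoint T (T (e i)) = ((T.singularValues i ^ 2 : ℝ) : ℂ) • e i := by
  refine ⟨T.isSymmetric_adjoint_comp_self.eigenvectorBasis rfl, fun i => ?_⟩
  rw [T.sq_singularValues_fin rfl]
  exact T.isSymmetric_adjoint_comp_self.apply_eigenvectorBasis rfl i

open Module LinearMap Finset Matrix in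
theorem re_det_gram_apply_le {E F : Type*} [NormedAddCommGroup E]
    [InnerProductSpace ℂ E] [FiniteDimensional ℂ E] [NormedAddCommGroup F]
    [InnerProductSpace ℂ F] [FiniteDimensional ℂ F] (T : E →ₗ[ℂ] F) {k : ℕ} (v : Fin k → E) :
    (gram ℂ fun i => T (v i)).det.re ≤
      (∏ i ∈ range k, T.singularValues i) ^ 2 * (gram ℂ v).det.re := by
  obtain ⟨e, he⟩ := exists_orthonormalBasis_adjoint_apply T
  obtain ⟨C, hC⟩ : ∃ C : Matrix (Fin (finrank ℂ E)) (Fin k) ℂ,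
      ∀ l i, C l i = inner ℂ (e l) (v i) := ⟨fun l i => inner ℂ (e l) (v i), fun _ _ => rfl⟩
  have hC' : ∀ l i, Cᴴ i l = inner ℂ (v i) (e l) := fun l i => by
    rw [conjTranspose_apply, hC]; exact inner_conj_symm _ _
  have h1 : gram ℂ v = Cᴴ * C := by
    ext i j
    simp only [mul_apply, gram_apply, hC, hC', e.sum_inner_mul_inner]
  have h2 : gram ℂ (fun i => T (v i)) =
      Cᴴ * diagonal (fun i : Fin (finrank ℂ E) => ((T.singularValues i ^ 2 : ℝ) : ℂ)) * C := by
    ext i j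
    rw [gram_apply, ← LinearMap.adjoint_inner_right, ← e.sum_inner_mul_inner, mul_apply]
    refine sum_congr rfl fun l _ => ?_
    rw [LinearMap.adjoint_inner_right, ← LinearMap.adjoint_inner_left, he, inner_smul_left,
      mul_diagonal, hC, hC', Complex.conj_ofReal]
    ring
  rw [h1, h2, ← prod_pow]
  exact re_det_conjTranspose_mul_diagonal_mul_le (d := fun i => T.singularValues i ^ 2) C
    (fun i j hij => pow_le_pow_left₀ (T.singularValues_nonneg j) (T.singularValues_antitone hij) 2)
    fun i => sq_nonneg _

open Module LinearMap Finset Matrix in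
/-- **Horn's inequality** for the singular values of a composition. -/
theorem prod_singularValues_comp_le {E F G : Type*} [NormedAddCommGroup E]
    [InnerProductSpace ℂ E] [FiniteDimensional ℂ E] [NormedAddCommGroup F]
    [InnerProductSpace ℂ F] [FiniteDimensional ℂ F] [NormedAddCommGroup G]
    [InnerProductSpace ℂ G] [FiniteDimensional ℂ G] (S : F →ₗ[ℂ] G) (T : E →ₗ[ℂ] F) {k : ℕ}
    (hk : k ≤ finrank ℂ E) :
    ∏ i ∈ range k, (S ∘ₗ T).singularValues i ≤
      ∏ i ∈ range k, (S.singularValues i * T.singularValues i) := by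
  -- On the top `k` right singular vectors of `S ∘ₗ T`, the Gram determinant of the images is the
  -- squared left side. It is bounded by removing `S`, then `T`.
  obtain ⟨e, he⟩ := exists_orthonormalBasis_adjoint_apply (S ∘ₗ T)
  set v : Fin k → E := fun i => e (Fin.castLE hk i) with hv
  have hvo : Orthonormal ℂ v := e.orthonormal.comp _ (Fin.castLE_injective hk)
  have h1 : gram ℂ v = 1 := by
    ext i j
    rw [gram_apply, orthonormal_iff_ite.1 hvo, one_apply]
  have h2 : gram ℂ (fun i => S (T (v i))) =
      diagonal fun i : Fin k => (((S ∘ₗ T).singularValues i ^ 2 : ℝ) : ℂ) := by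
    ext i j
    rw [gram_apply]
    change inner ℂ ((S ∘ₗ T) (v i)) ((S ∘ₗ T) (v j)) = _
    rw [← LinearMap.adjoint_inner_left, he, inner_smul_left]
    change _ * inner ℂ (v i) (v j) = _
    rw [orthonormal_iff_ite.1 hvo, diagonal_apply]
    split_ifs <;> simp
  have h3 := re_det_gram_apply_le S fun i => T (v i)
  have h4 := re_det_gram_apply_le T v
  rw [h2, det_diagonal, ← Complex.ofReal_prod, Complex.ofReal_re,
    Fin.prod_univ_eq_prod_range (fun i => (S ∘ₗ T).singularValues i ^ 2), prod_pow] at h3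
  rw [h1, det_one, Complex.one_re, mul_one] at h4
  rw [prod_mul_distrib]
  refine le_of_sq_le_sq (h3.trans ?_) ?_
  · rw [mul_pow]
    exact mul_le_mul_of_nonneg_left h4 (sq_nonneg _)
  · exact mul_nonneg (prod_nonneg fun i _ => S.singularValues_nonneg i)
      (prod_nonneg fun i _ => T.singularValues_nonneg i)

open Module LinearMap Finset in
theorem sum_singularValues_comp_rpow_le {E F G : Type*} [NormedAddCommGroup E]
    [InnerProductSpace ℂ E] [FiniteDimensional ℂ E] [NormedAddCommGroup F]
    [InnerProductSpace ℂ F] [FiniteDimensional ℂ F] [NormedAddCommGroup G]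
    [InnerProductSpace ℂ G] [FiniteDimensional ℂ G] (S : F →ₗ[ℂ] G) (T : E →ₗ[ℂ] F) {r : ℝ}
    (hr : 0 ≤ r) :
    ∑ i ∈ range (finrank ℂ E), (S ∘ₗ T).singularValues i ^ r ≤
      ∑ i ∈ range (finrank ℂ E), (S.singularValues i * T.singularValues i) ^ r := by
  have hm : ∀ i, 0 ≤ S.singularValues i * T.singularValues i := fun i =>
    mul_nonneg (S.singularValues_nonneg i) (T.singularValues_nonneg i)
  refine sum_range_le_of_prod_range_le (fun i j hij => Real.rpow_le_rpow
    (singularValues_nonneg _ _) (singularValues_antitone _ hij) hr)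
    (fun i => Real.rpow_nonneg (singularValues_nonneg _ _) _)
    (fun i => Real.rpow_nonneg (hm i) _) _ fun k hk => ?_
  rw [Real.finsetProd_rpow _ _ fun i _ => singularValues_nonneg _ _,
    Real.finsetProd_rpow _ _ fun i _ => hm i]
  exact Real.rpow_le_rpow (prod_nonneg fun i _ => singularValues_nonneg _ _)
    (prod_singularValues_comp_le S T hk) hr

/-! ### Schatten norms through singular values -/

open Module in
theorem finite_spectrum_real {H : Type*} [NormedAddCommGroup H] [InnerProductSpace ℂ H]
    [CompleteSpace H] [FiniteDimensional ℂ H] (P : H →L[ℂ] H) : (spectrum ℝ P).Finite := by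
  have h : (spectrum ℂ P).Finite := by
    rw [← AlgEquiv.spectrum_eq (Module.End.toContinuousLinearMap H).symm P]
    exact Module.End.finite_spectrum _
  exact h.preimage (FaithfulSMul.algebraMap_injective ℝ ℂ).injOn

open Polynomial in
theorem cfc_apply_of_apply_eq_smul {H : Type*} [NormedAddCommGroup H] [InnerProductSpace ℂ H]
    [CompleteSpace H] [FiniteDimensional ℂ H] {P : H →L[ℂ] H} (hP : IsSelfAdjoint P) (f : ℝ → ℝ)
    {c : ℝ} {v : H} (hv : P v = (c : ℂ) • v) : cfc f P v = (f c : ℂ) • v := by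
  -- On a finite spectrum `f` is a polynomial. The node `c` is added since it may lie off the
  -- spectrum when `v = 0`.
  obtain ⟨q, hq⟩ : ∃ q : ℝ[X], ∀ x ∈ insert c (spectrum ℝ P), q.eval x = f x := by
    have hfin := (finite_spectrum_real P).insert c
    exact ⟨Lagrange.interpolate hfin.toFinset id f, fun x hx =>
      Lagrange.eval_interpolate_at_node f Function.injective_id.injOn (hfin.mem_toFinset.2 hx)⟩
  have hcfc : cfc f P = aeval P q := by
    rw [← cfc_polynomial q P]
    exact cfc_congr fun x hx => (hq x (Set.mem_insert_of_mem _ hx)).symm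
  rw [hcfc, ← hq c (Set.mem_insert _ _)]
  clear hq hcfc
  induction q using Polynomial.induction_on with
  | C a => simp [Algebra.algebraMap_eq_smul_one]
  | add p q hp hq => simp [hp, hq, add_smul]
  | monomial n a h =>
    rw [pow_succ, ← mul_assoc, map_mul, aeval_X, mul_apply_eq_comp, hv, map_smul, h,
      smul_smul, eval_mul (q := X), eval_X, Complex.ofReal_mul, mul_comm (c : ℂ)]

open LinearMap Module Finset in
theorem opTrace_star_mul_self_rpow {H : Type*} [NormedAddCommGroup H] [InnerProductSpace ℂ H]
    [CompleteSpace H] [FiniteDimensional ℂ H] (L : H →L[ℂ] H) (s : ℝ) :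
    opTrace ((star L * L) ^ s) =
      ∑ i ∈ range (finrank ℂ H), (L : H →ₗ[ℂ] H).singularValues i ^ (2 * s) := by
  obtain ⟨e, he⟩ := exists_orthonormalBasis_adjoint_apply (L : H →ₗ[ℂ] H)
  have h1 : ∀ i, ((star L * L) ^ s) (e i) =
      (((L : H →ₗ[ℂ] H).singularValues i ^ (2 * s) : ℝ) : ℂ) • e i := by
    intro i
    rw [CFC.rpow_eq_cfc_real (star_mul_self_nonneg L), Real.rpow_mul (singularValues_nonneg _ _),
      Real.rpow_two]
    exact cfc_apply_of_apply_eq_smul (IsSelfAdjoint.star_mul_self L) (fun x => x ^ s) (he i)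
  rw [opTrace, LinearMap.trace_eq_sum_inner _ e]
  simp_rw [ContinuousLinearMap.coe_coe, h1, inner_smul_right, inner_self_eq_norm_sq_to_K,
    e.norm_eq_one]
  simp only [Complex.re_sum, RCLike.ofReal_one, one_pow, mul_one, Complex.ofReal_re]
  exact Fin.sum_univ_eq_sum_range
    (fun i => (L : H →ₗ[ℂ] H).singularValues i ^ (2 * s)) _

open LinearMap Module Finset in
theorem schattenNorm_eq_sum {H : Type*} [NormedAddCommGroup H] [InnerProductSpace ℂ H]
    [CompleteSpace H] [FiniteDimensional ℂ H] {p : ENNReal} (hp : p ≠ ⊤) (L : H →L[ℂ] H) :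
    schattenNorm p L = (∑ i ∈ range (finrank ℂ H),
      (L : H →ₗ[ℂ] H).singularValues i ^ p.toReal) ^ (1 / p.toReal) := by
  rw [schattenNorm, if_neg hp, CFC.abs, CFC.sqrt_eq_rpow,
    CFC.rpow_rpow_of_exponent_nonneg _ _ _ (by norm_num) ENNReal.toReal_nonneg
      (star_mul_self_nonneg L), opTrace_star_mul_self_rpow]
  congr! 4
  ring

theorem schattenNorm_nonneg {H : Type*} [NormedAddCommGroup H] [InnerProductSpace ℂ H]
    [CompleteSpace H] [FiniteDimensional ℂ H] (p : ENNReal) (L : H →L[ℂ] H) :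
    0 ≤ schattenNorm p L := by
  by_cases hp : p = ⊤
  · simp [schattenNorm, hp]
  · rw [schattenNorm_eq_sum hp]
    exact Real.rpow_nonneg (Finset.sum_nonneg fun i _ =>
      Real.rpow_nonneg (LinearMap.singularValues_nonneg _ _) _) _

/-- The Schatten norm to the power of its exponent, as the trace of a power of `L* L`. -/
theorem opTrace_star_mul_self_rpow_eq_schattenNorm {H : Type*} [NormedAddCommGroup H]
    [InnerProductSpace ℂ H] [CompleteSpace H] [FiniteDimensional ℂ H] (L : H →L[ℂ] H) {s : ℝ}
    (hs : 0 < s) :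
    opTrace ((star L * L) ^ s) = schattenNorm (ENNReal.ofReal (2 * s)) L ^ (2 * s) := by
  rw [schattenNorm_eq_sum ENNReal.ofReal_ne_top, ENNReal.toReal_ofReal (by positivity),
    opTrace_star_mul_self_rpow, ← Real.rpow_mul, one_div_mul_cancel (by positivity),
    Real.rpow_one]
  exact Finset.sum_nonneg fun i _ => Real.rpow_nonneg (LinearMap.singularValues_nonneg _ _) _

open LinearMap Module in
theorem singularValues_le_norm {H : Type*} [NormedAddCommGroup H] [InnerProductSpace ℂ H]
    [CompleteSpace H] [FiniteDimensional ℂ H] (L : H →L[ℂ] H) (i : ℕ) :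
    (L : H →ₗ[ℂ] H).singularValues i ≤ ‖L‖ := by
  rcases le_or_gt (finrank ℂ H) i with hi | hi
  · rw [singularValues_of_finrank_le _ hi]
    exact norm_nonneg L
  obtain ⟨e, he⟩ := exists_orthonormalBasis_adjoint_apply (L : H →ₗ[ℂ] H)
  have h1 : (L : H →ₗ[ℂ] H).singularValues i ^ 2 = ‖L (e ⟨i, hi⟩)‖ ^ 2 := by
    have h2 : inner ℂ (L (e ⟨i, hi⟩)) (L (e ⟨i, hi⟩)) =
        (((L : H →ₗ[ℂ] H).singularValues i ^ 2 : ℝ) : ℂ) := by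
      change inner ℂ ((L : H →ₗ[ℂ] H) (e ⟨i, hi⟩)) ((L : H →ₗ[ℂ] H) (e ⟨i, hi⟩)) = _
      rw [← LinearMap.adjoint_inner_right, he, inner_smul_right, inner_self_eq_norm_sq_to_K,
        e.norm_eq_one]
      simp
    rw [inner_self_eq_norm_sq_to_K] at h2
    exact Complex.ofReal_injective (by rw [← h2]; push_cast; rfl)
  have h3 := L.le_opNorm (e ⟨i, hi⟩)
  rw [e.norm_eq_one, mul_one] at h3
  rwa [(sq_eq_sq₀ (singularValues_nonneg _ _) (norm_nonneg _)).1 h1]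

/-! ### Hölder's inequality -/

open Finset in
theorem rpow_sum_mul_rpow_le {ι : Type*} (s : Finset ι) {f g : ι → ℝ} {c r : ℝ} (hr : 0 < r)
    (hc : 0 ≤ c) (hf0 : ∀ i, 0 ≤ f i) (hg0 : ∀ i, 0 ≤ g i) (hf : ∀ i, f i ≤ c) :
    (∑ i ∈ s, (f i * g i) ^ r) ^ (1 / r) ≤ c * (∑ i ∈ s, g i ^ r) ^ (1 / r) := by
  have hsum : 0 ≤ ∑ i ∈ s, g i ^ r := sum_nonneg fun i _ => Real.rpow_nonneg (hg0 i) _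
  have h : ∑ i ∈ s, (f i * g i) ^ r ≤ c ^ r * ∑ i ∈ s, g i ^ r := by
    rw [mul_sum]
    refine sum_le_sum fun i _ => ?_
    rw [← Real.mul_rpow hc (hg0 i)]
    exact Real.rpow_le_rpow (mul_nonneg (hf0 i) (hg0 i))
      (mul_le_mul_of_nonneg_right (hf i) (hg0 i)) hr.le
  calc _ ≤ (c ^ r * ∑ i ∈ s, g i ^ r) ^ (1 / r) :=
        Real.rpow_le_rpow (sum_nonneg fun i _ =>
          Real.rpow_nonneg (mul_nonneg (hf0 i) (hg0 i)) _) h (by positivity)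
    _ = _ := by
        rw [Real.mul_rpow (Real.rpow_nonneg hc _) hsum, ← Real.rpow_mul hc,
          mul_one_div_cancel hr.ne', Real.rpow_one]

open LinearMap Module Finset in
/-- **Hölder's inequality** for Schatten (quasi-)norms, for all positive exponents. -/
theorem schattenNorm_mul_le {H : Type*} [NormedAddCommGroup H] [InnerProductSpace ℂ H]
    [CompleteSpace H] [FiniteDimensional ℂ H] {p q r : ENNReal} (hp : p ≠ 0) (hq : q ≠ 0)
    (h : r⁻¹ = p⁻¹ + q⁻¹) (S T : H →L[ℂ] H) :
    schattenNorm r (S * T) ≤ schattenNorm p S * schattenNorm q T := by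
  have hr0 : r ≠ 0 := by
    rintro rfl
    rw [ENNReal.inv_zero] at h
    exact ENNReal.add_ne_top.2 ⟨ENNReal.inv_ne_top.2 hp, ENNReal.inv_ne_top.2 hq⟩ h.symm
  have hS := (S : H →ₗ[ℂ] H).singularValues_nonneg
  have hT := (T : H →ₗ[ℂ] H).singularValues_nonneg
  -- Horn's inequality reduces the claim to scalar Hölder for the two singular value sequences.
  have hmul : r ≠ ⊤ → schattenNorm r (S * T) ≤
      (∑ i ∈ range (finrank ℂ H), ((S : H →ₗ[ℂ] H).singularValues i *
        (T : H →ₗ[ℂ] H).singularValues i) ^ r.toReal) ^ (1 / r.toReal) := by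
    intro hr
    rw [schattenNorm_eq_sum hr]
    exact Real.rpow_le_rpow (sum_nonneg fun i _ => Real.rpow_nonneg (singularValues_nonneg _ _) _)
      (sum_singularValues_comp_rpow_le (S : H →ₗ[ℂ] H) (T : H →ₗ[ℂ] H) ENNReal.toReal_nonneg)
      (one_div_nonneg.2 ENNReal.toReal_nonneg)
  by_cases hpt : p = ⊤
  · subst hpt
    obtain rfl : r = q := by simpa using h
    by_cases hrt : r = ⊤
    · subst hrt
      simpa [schattenNorm] using norm_mul_le S T
    · refine (hmul hrt).trans ?_
      rw [schattenNorm_eq_sum hrt T, schattenNorm, if_pos rfl]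
      exact rpow_sum_mul_rpow_le _ (ENNReal.toReal_pos hr0 hrt) (norm_nonneg S) hS hT
        (singularValues_le_norm S)
  by_cases hqt : q = ⊤
  · subst hqt
    obtain rfl : r = p := by simpa using h
    refine (hmul hpt).trans ?_
    rw [schattenNorm_eq_sum hpt S, schattenNorm, if_pos rfl, mul_comm]
    simp_rw [mul_comm (singularValues (S : H →ₗ[ℂ] H) _)]
    exact rpow_sum_mul_rpow_le _ (ENNReal.toReal_pos hr0 hpt) (norm_nonneg T) hT hS
      (singularValues_le_norm T)
  have hrt : r ≠ ⊤ := by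
    rintro rfl
    rw [ENNReal.inv_top] at h
    exact hpt (ENNReal.inv_eq_zero.1 (add_eq_zero.1 h.symm).1)
  have htriple : p.toReal.HolderTriple q.toReal r.toReal := by
    refine ⟨?_, ENNReal.toReal_pos hp hpt, ENNReal.toReal_pos hq hqt⟩
    rw [← ENNReal.toReal_inv, ← ENNReal.toReal_inv, ← ENNReal.toReal_inv, h,
      ENNReal.toReal_add (ENNReal.inv_ne_top.2 hp) (ENNReal.inv_ne_top.2 hq)]
  refine (hmul hrt).trans ?_
  rw [schattenNorm_eq_sum hpt, schattenNorm_eq_sum hqt]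
  have hr := ENNReal.toReal_pos hr0 hrt
  have hS' : 0 ≤ ∑ i ∈ range (finrank ℂ H), (S : H →ₗ[ℂ] H).singularValues i ^ p.toReal :=
    sum_nonneg fun i _ => Real.rpow_nonneg (hS i) _
  have hT' : 0 ≤ ∑ i ∈ range (finrank ℂ H), (T : H →ₗ[ℂ] H).singularValues i ^ q.toReal :=
    sum_nonneg fun i _ => Real.rpow_nonneg (hT i) _
  refine (Real.rpow_le_rpow (sum_nonneg fun i _ => Real.rpow_nonneg (mul_nonneg (hS i) (hT i)) _)
    (Real.Lr_rpow_le_Lp_mul_Lq_of_nonneg _ htriple (fun i _ => hS i) fun i _ => hT i)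
    (one_div_nonneg.2 hr.le)).trans_eq ?_
  rw [Real.mul_rpow (Real.rpow_nonneg hS' _) (Real.rpow_nonneg hT' _), ← Real.rpow_mul hS',
    ← Real.rpow_mul hT']
  congr 2 <;> field_simp

theorem schattenNorm_mul_mul_le {H : Type*} [NormedAddCommGroup H] [InnerProductSpace ℂ H]
    [CompleteSpace H] [FiniteDimensional ℂ H] {a b c r : ENNReal} (ha : a ≠ 0) (hb : b ≠ 0)
    (hc : c ≠ 0) (h : r⁻¹ = c⁻¹ + a⁻¹ + b⁻¹) (X Y Z : H →L[ℂ] H) :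
    schattenNorm r (X * Y * Z) ≤ schattenNorm c Y * schattenNorm a X * schattenNorm b Z := by
  have hd : (c⁻¹ + a⁻¹)⁻¹ ≠ 0 := by simp [ha, hc]
  have h1 := schattenNorm_mul_le hd hb (by rw [h, inv_inv]) (X * Y) Z
  have h2 := schattenNorm_mul_le (r := (c⁻¹ + a⁻¹)⁻¹) ha hc (by rw [inv_inv, add_comm]) X Y
  rw [mul_comm (schattenNorm c Y)]
  exact h1.trans (mul_le_mul_of_nonneg_right h2 (schattenNorm_nonneg b Z))

/-! ### Operator powers and the main theorem -/

theorem rpow_mul_rpow_of_nonneg {H : Type*} [NormedAddCommGroup H] [InnerProductSpace ℂ H]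
    [CompleteSpace H] (A : H →L[ℂ] H) {x y z : ℝ} (hx : 0 ≤ x) (hy : 0 ≤ y)
    (hz : x + y = z) : A ^ x * A ^ y = A ^ z := by
  subst hz
  simp only [CFC.rpow_def]
  rw [← cfc_mul _ _ A]
  exact cfc_congr fun t _ => (NNReal.rpow_add_of_nonneg t hx hy).symm

theorem star_mul_self_rpow_half {H : Type*} [NormedAddCommGroup H] [InnerProductSpace ℂ H]
    [CompleteSpace H] (A B : H →L[ℂ] H) {s : ℝ} (hs : 0 ≤ s) :
    star (A ^ (s / 2) * B ^ (s / 2)) * (A ^ (s / 2) * B ^ (s / 2)) =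
      B ^ (s / 2) * A ^ s * B ^ (s / 2) := by
  rw [star_mul, (IsSelfAdjoint.of_nonneg CFC.rpow_nonneg).star_eq,
    (IsSelfAdjoint.of_nonneg CFC.rpow_nonneg).star_eq,
    ← rpow_mul_rpow_of_nonneg A (by positivity) (by positivity) (add_halves s)]
  simp only [mul_assoc]

theorem theorem1 {H : Type*} [NormedAddCommGroup H] [InnerProductSpace ℂ H]
    [CompleteSpace H] [FiniteDimensional ℂ H]
    (A B : H →L[ℂ] H) (hA : A.IsPositive) (hB : B.IsPositive) (q : ℝ) (hq : 0 < q) :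
    (∀ (r : ℝ) (a b : ENNReal), 0 < r → r ≤ 1 → 0 < a → 0 < b →
      ENNReal.ofReal (1 / (2 * r * q)) = ENNReal.ofReal (1 / (2 * q)) + 1 / a + 1 / b →
      opTrace ((B ^ (1 / 2 : ℝ) * A * B ^ (1 / 2 : ℝ)) ^ (r * q)) ≤
        opTrace ((B ^ (r / 2) * A ^ r * B ^ (r / 2)) ^ q) ^ r
          * schattenNorm a (A ^ ((1 - r) / 2)) ^ (2 * r * q)
          * schattenNorm b (B ^ ((1 - r) / 2)) ^ (2 * r * q)) ∧
    (∀ (r : ℝ) (a b : ENNReal), 1 ≤ r → 0 < a → 0 < b →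
      ENNReal.ofReal (1 / (2 * q)) = ENNReal.ofReal (1 / (2 * r * q)) + 1 / a + 1 / b →
      opTrace ((B ^ (1 / 2 : ℝ) * A * B ^ (1 / 2 : ℝ)) ^ (r * q)) ≥
        opTrace ((B ^ (r / 2) * A ^ r * B ^ (r / 2)) ^ q) ^ r
          * schattenNorm a (A ^ ((r - 1) / 2)) ^ (-(2 * r * q))
          * schattenNorm b (B ^ ((r - 1) / 2)) ^ (-(2 * r * q))) := by
  have hA0 : 0 ≤ A := (ContinuousLinearMap.nonneg_iff_isPositive A).2 hA
  have hleft : ∀ r : ℝ, 0 < r → opTrace ((B ^ (1 / 2 : ℝ) * A * B ^ (1 / 2 : ℝ)) ^ (r * q)) =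
      schattenNorm (ENNReal.ofReal (2 * r * q)) (A ^ (1 / 2 : ℝ) * B ^ (1 / 2 : ℝ)) ^
        (2 * r * q) := by
    intro r hr
    have h := star_mul_self_rpow_half A B zero_le_one
    rw [CFC.rpow_one A] at h
    rw [← h, opTrace_star_mul_self_rpow_eq_schattenNorm _ (mul_pos hr hq), mul_assoc 2 r q]
  have hright : ∀ r : ℝ, 0 < r → opTrace ((B ^ (r / 2) * A ^ r * B ^ (r / 2)) ^ q) ^ r =
      schattenNorm (ENNReal.ofReal (2 * q)) (A ^ (r / 2) * B ^ (r / 2)) ^ (2 * r * q) := by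
    intro r hr
    rw [← star_mul_self_rpow_half A B hr.le, opTrace_star_mul_self_rpow_eq_schattenNorm _ hq,
      ← Real.rpow_mul (schattenNorm_nonneg _ _), mul_right_comm]
  have hinv : ∀ x : ℝ, 0 < x → ENNReal.ofReal (1 / x) = (ENNReal.ofReal x)⁻¹ := fun x hx => by
    rw [one_div, ENNReal.ofReal_inv_of_pos hx]
  have h2q : 0 < 2 * q := by positivity
  refine ⟨fun r a b hr hr1 ha hb h => ?_, fun r a b hr1 ha hb h => ?_⟩
  · have hrq : 0 < 2 * r * q := by positivity
    rw [hinv _ hrq, hinv _ h2q, one_div, one_div] at h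
    have hH := schattenNorm_mul_mul_le ha.ne' hb.ne' (ENNReal.ofReal_pos.2 h2q).ne' h
      (A ^ ((1 - r) / 2)) (A ^ (r / 2) * B ^ (r / 2)) (B ^ ((1 - r) / 2))
    rw [← mul_assoc, rpow_mul_rpow_of_nonneg A (z := 1 / 2) (by linarith)
      (by linarith) (by ring), mul_assoc (A ^ (1 / 2 : ℝ)), rpow_mul_rpow_of_nonneg B (z := 1 / 2) (by linarith)
      (by linarith) (by ring)] at hH
    rw [hleft r hr, hright r hr,
      ← Real.mul_rpow (schattenNorm_nonneg _ _) (schattenNorm_nonneg _ _),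
      ← Real.mul_rpow (mul_nonneg (schattenNorm_nonneg _ _) (schattenNorm_nonneg _ _))
        (schattenNorm_nonneg _ _)]
    exact Real.rpow_le_rpow (schattenNorm_nonneg _ _) hH hrq.le
  · have hr : 0 < r := by linarith
    have hrq : 0 < 2 * r * q := by positivity
    rw [hinv _ hrq, hinv _ h2q, one_div, one_div] at h
    have hH := schattenNorm_mul_mul_le ha.ne' hb.ne' (ENNReal.ofReal_pos.2 hrq).ne' h
      (A ^ ((r - 1) / 2)) (A ^ (1 / 2 : ℝ) * B ^ (1 / 2 : ℝ)) (B ^ ((r - 1) / 2))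
    rw [← mul_assoc, rpow_mul_rpow_of_nonneg A (z := r / 2) (by linarith)
      (by norm_num) (by ring), mul_assoc (A ^ (r / 2)), rpow_mul_rpow_of_nonneg B (z := r / 2) (by norm_num)
      (by linarith) (by ring)] at hH
    rw [hleft r hr, hright r hr]
    -- A zero norm to a negative power is `0` here, so the right side vanishes, as the stated
    -- convention asks.
    rcases (schattenNorm_nonneg a (A ^ ((r - 1) / 2))).eq_or_lt with hNa | hNa
    · rw [← hNa, Real.zero_rpow (neg_ne_zero.2 hrq.ne'), mul_zero, zero_mul]
      exact Real.rpow_nonneg (schattenNorm_nonneg _ _) _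
    rcases (schattenNorm_nonneg b (B ^ ((r - 1) / 2))).eq_or_lt with hNb | hNb
    · rw [← hNb, Real.zero_rpow (neg_ne_zero.2 hrq.ne'), mul_zero]
      exact Real.rpow_nonneg (schattenNorm_nonneg _ _) _
    rw [ge_iff_le, Real.rpow_neg hNa.le, Real.rpow_neg hNb.le, ← div_eq_mul_inv, ← div_eq_mul_inv,
      div_le_iff₀ (Real.rpow_pos_of_pos hNb _), div_le_iff₀ (Real.rpow_pos_of_pos hNa _),
      mul_right_comm (schattenNorm _ _ ^ _),
      ← Real.mul_rpow (schattenNorm_nonneg _ _) hNa.le,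
      ← Real.mul_rpow (mul_nonneg (schattenNorm_nonneg _ _) hNa.le) hNb.le]
    exact Real.rpow_le_rpow (schattenNorm_nonneg _ _) hH hrq.le
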